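/- Let $G=\langle a,b \mid bababAb^2A,\ ababaBa^2B\rangle$, where $A=a^{-1}$ and $B=b^{-1}$; this is the standard presentation of the fundamental group of the Weeks manifold (the closed hyperbolic $3$-manifold obtained by $(5/2,5/1)$ Dehn surgery on the Whitehead link). Then $G$ has no faithful action on the circle $S^1$ by homeomorphisms: there is no injective group homomorphism $G\to\mathrm{Homeo}(S^1)$, where $\mathrm{Homeo}(S^1)$ is the group of all self-homeomorphisms of $S^1$, orientation-preserving or not. -/

import Mathlib

/-- The two relators `b a b a b A b² A` and `a b a b a B a² B` in the free group on the two
generators `a` and `b`, where `A = a⁻¹` and `B = b⁻¹`. -/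
def weeksRelators : Set (FreeGroup (Fin 2)) :=
  let a : FreeGroup (Fin 2) := FreeGroup.of 0
  let b : FreeGroup (Fin 2) := FreeGroup.of 1
  {b * a * b * a * b * a⁻¹ * b ^ 2 * a⁻¹, a * b * a * b * a * b⁻¹ * a ^ 2 * b⁻¹}

/-- The fundamental group of the Weeks manifold, the closed hyperbolic 3-manifold obtained by
`(5/2, 5/1)` Dehn surgery on the Whitehead link, given by its presentation
`⟨a, b | bababAb²A, ababaBa²B⟩`. -/
abbrev WeeksGroup : Type := PresentedGroup weeksRelators

/-! The abelianization of the Weeks group is `(ℤ/5)²`, so the Euler class of an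
orientation-preserving circle action is 5-torsion and dies on the kernel of some character to `ℤ/5`.
That kernel then acts on the line, and faithfulness makes it left-orderable. The contradiction is
that no such kernel is left-orderable.

Concretely, lifts of the two generators to `ℝ` turn the relators into translations by `m` and `n`
turns. The relators have exponent sums `(0, 5)` and `(5, 0)`, so every element preserves orientation
(`strictMono_of_relators`) and lifts commute with `turn`. If `φ` sends `a` to `n` and `b` to `m`, a
trivial word with `φ = 5k` lifts to `turn ^ k` (`eq_turn_zpow_of_mk_eq_one`). Hence correcting the
lift of a word with `φ = 5k` by `turn ^ (-k)` is well defined on the kernel of `χ = φ mod 5`, and a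
left order on homeomorphisms of the line pulls back to a positive cone there.

Up to symmetries of the presentation only two kernels occur (`not_total_on_ker`). For each, a finite
tree of sign choices is checked, in which every branch produces a product of positive elements equal
to `1`. -/

/-! ### Words and certified consequences of the relations. -/

/-- The generators of the Weeks group and their inverses, as symbols. -/
inductive WeeksLetter
  | a | b | A | B
  deriving DecidableEq

/-- Words in the generators of the Weeks group and their inverses. -/
abbrev WeeksWord := List WeeksLetter

open WeeksLetter

section Words

variable {H K : Type*} [Group H] [Group K]

/-- The formal inverse of a letter. -/
protected def WeeksLetter.inv : WeeksLetter → WeeksLetter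
  | a => A
  | b => B
  | A => a
  | B => b

/-- The value of a letter when the generators are interpreted as `x` and `y`. -/
protected def WeeksLetter.eval (x y : H) : WeeksLetter → H
  | a => x
  | b => y
  | A => x⁻¹
  | B => y⁻¹

@[simp]
theorem WeeksLetter.eval_inv (x y : H) (c : WeeksLetter) : c.inv.eval x y = (c.eval x y)⁻¹ := by
  cases c <;> simp [WeeksLetter.inv, WeeksLetter.eval]

/-- The value of a word when the generators are interpreted as `x` and `y`. -/
def WeeksWord.eval (x y : H) (w : WeeksWord) : H :=
  (w.map (WeeksLetter.eval x y)).prod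

/-- The formal inverse of a word. -/
def WeeksWord.inv (w : WeeksWord) : WeeksWord :=
  (w.map WeeksLetter.inv).reverse

/-- Prepend a letter to a word, cancelling it against the first letter if possible. -/
def WeeksWord.push (c : WeeksLetter) : WeeksWord → WeeksWord
  | [] => [c]
  | d :: w => if d = c.inv then w else c :: d :: w

/-- Free reduction of a word. -/
def WeeksWord.reduce (w : WeeksWord) : WeeksWord :=
  w.foldr WeeksWord.push []

namespace WeeksWord

variable (x y : H)

@[simp]
theorem eval_nil : eval x y [] = 1 := rfl

@[simp]
theorem eval_cons (c : WeeksLetter) (w : WeeksWord) :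
    eval x y (c :: w) = c.eval x y * eval x y w := by
  simp [eval]

@[simp]
theorem eval_append (v w : WeeksWord) : eval x y (v ++ w) = eval x y v * eval x y w := by
  simp [eval]

@[simp]
theorem eval_inv (w : WeeksWord) : eval x y w.inv = (eval x y w)⁻¹ := by
  induction w with
  | nil => simp [inv]
  | cons c w ih =>
    have h : inv (c :: w) = inv w ++ [c.inv] := by simp [inv]
    rw [h, eval_append, ih]
    simp

theorem eval_push (c : WeeksLetter) (w : WeeksWord) :
    eval x y (push c w) = c.eval x y * eval x y w := by
  cases w with
  | nil => simp [push]
  | cons d w =>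
    rw [push]
    split_ifs with h
    · subst h
      simp
    · simp

@[simp]
theorem eval_reduce (w : WeeksWord) : eval x y w.reduce = eval x y w := by
  induction w with
  | nil => rfl
  | cons c w ih =>
    have h : reduce (c :: w) = push c (reduce w) := rfl
    rw [h, eval_push, ih, eval_cons]

theorem eval_flatten (l : List WeeksWord) : eval x y l.flatten = (l.map (eval x y)).prod := by
  induction l with
  | nil => rfl
  | cons w l ih => simp [ih]

theorem map_eval (f : H →* K) (w : WeeksWord) : f (eval x y w) = eval (f x) (f y) w := by
  induction w with
  | nil => simp
  | cons c w ih => cases c <;> simp [ih, WeeksLetter.eval]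

end WeeksWord

open WeeksWord

/-- The relator `b a b a b A b² A` as a word. -/
def firstRelator : WeeksWord := [b, a, b, a, b, A, b, b, A]

/-- The relator `a b a b a B a² B` as a word. -/
def secondRelator : WeeksWord := [a, b, a, b, a, B, a, a, B]

/-- The cyclic rotations of the two relators and of their inverses. -/
def relatorRotations : List WeeksWord :=
  [firstRelator, firstRelator.inv, secondRelator, secondRelator.inv].flatMap
    fun r => (List.range 9).map r.rotate

/-- Two group elements satisfy the relations of the Weeks group. -/
structure WeeksPair (x y : H) : Prop where
  first : eval x y firstRelator = 1
  second : eval x y secondRelator = 1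

theorem WeeksPair.eval_relatorRotation {x y : H} (h : WeeksPair x y) {r : WeeksWord}
    (hr : r ∈ relatorRotations) : eval x y r = 1 := by
  have key : ∀ (s : WeeksWord) (k : ℕ), eval x y s = 1 → eval x y (s.rotate k) = 1 := by
    intro s k hs
    rw [WeeksWord.eval, List.map_rotate]
    exact List.prod_rotate_eq_one_of_prod_eq_one hs k
  simp only [relatorRotations, List.mem_flatMap, List.mem_map, List.mem_cons, List.not_mem_nil,
    or_false] at hr
  obtain ⟨s, hs, k, -, rfl⟩ := hr
  apply key
  rcases hs with rfl | rfl | rfl | rfl <;> simp [h.first, h.second]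

/-- Check that a word becomes empty under free reduction and successive insertions of relators;
each step gives the position of the insertion and the index of the inserted relator. -/
def WeeksWord.trivialBy : WeeksWord → List (ℕ × ℕ) → Bool
  | w, [] => w.reduce.isEmpty
  | w, (i, k) :: s =>
    trivialBy (w.reduce.take i ++ (relatorRotations.getD k [] ++ w.reduce.drop i)) s

/-- Neither free reduction nor the insertion of a relator changes the value of a word. An index out
of range inserts the empty word, which is harmless. -/
theorem WeeksPair.eval_eq_one_of_trivialBy {x y : H} (h : WeeksPair x y) (s : List (ℕ × ℕ))
    (w : WeeksWord) (hw : w.trivialBy s = true) : eval x y w = 1 := by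
  induction s generalizing w with
  | nil =>
    rw [trivialBy, List.isEmpty_iff] at hw
    rw [← eval_reduce, hw, eval_nil]
  | cons ik s ih =>
    obtain ⟨i, k⟩ := ik
    rw [trivialBy] at hw
    have h1 := ih _ hw
    have h2 : eval x y (relatorRotations.getD k []) = 1 := by
      rw [List.getD_eq_getElem?_getD]
      cases hk : relatorRotations[k]? with
      | none => rfl
      | some r => exact h.eval_relatorRotation (List.mem_of_getElem? hk)
    rw [eval_append, eval_append, h2, one_mul, ← eval_append, List.take_append_drop,
      eval_reduce] at h1
    exact h1

/-! ### Refutation trees for positive cones. -/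

/-- A refutation of the existence of a positive cone: either a product of positive words which is
trivial, or a case distinction according to whether a word or its inverse is positive. -/
inductive Refutation
  | product (factors : List WeeksWord) (steps : List (ℕ × ℕ))
  | split (w : WeeksWord) (pos neg : Refutation)

namespace Refutation

/-- The words on which a refutation makes a case distinction. -/
def words : Refutation → List WeeksWord
  | product _ _ => []
  | split w s t => w :: (s.words ++ t.words)

/-- The correctness check of a refutation relative to a list of words assumed positive. -/
def check : List WeeksWord → Refutation → Bool
  | l, product f s => !f.isEmpty && f.all (l.contains ·) && trivialBy f.flatten s
  | l, split w s t => s.check (w :: l) && t.check (w.inv :: l)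

/-- Soundness of the checker: at each split, totality selects a branch whose added assumption holds
in `P`. A leaf that checked would put a nonempty product equal to `1` in `P`. -/
theorem not_total {x y : H} (h : WeeksPair x y) (P : Subsemigroup H) (hP : (1 : H) ∉ P)
    (t : Refutation) (l : List WeeksWord) (hl : ∀ w ∈ l, eval x y w ∈ P)
    (ht : ∀ w ∈ t.words, eval x y w ∈ P ∨ (eval x y w)⁻¹ ∈ P) : t.check l = false := by
  induction t generalizing l with
  | product f s =>
    by_contra hc
    simp only [check, Bool.not_eq_false, Bool.and_eq_true, Bool.not_eq_true',
      List.isEmpty_eq_false_iff, List.all_eq_true, List.contains_iff_mem] at hc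
    obtain ⟨⟨hf, hfl⟩, hs⟩ := hc
    have key : ∀ g : List WeeksWord, g ≠ [] → (∀ w ∈ g, w ∈ l) →
        (g.map (WeeksWord.eval x y)).prod ∈ P := by
      intro g
      induction g with
      | nil => simp
      | cons w g ih =>
        intro _ hg
        rw [List.map_cons, List.prod_cons]
        rcases eq_or_ne g [] with rfl | hne
        · simpa using hl w (hg w (by simp))
        · exact P.mul_mem (hl w (hg w (by simp)))
            (ih hne fun v hv => hg v (List.mem_cons_of_mem _ hv))
    have h1 := key f hf hfl
    rw [← eval_flatten, h.eval_eq_one_of_trivialBy s _ hs] at h1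
    exact hP h1
  | split w s t ihs iht =>
    simp only [words, List.mem_cons, List.mem_append] at ht
    rw [check, Bool.and_eq_false_iff]
    rcases ht w (Or.inl rfl) with hw | hw
    · left
      refine ihs _ ?_ fun v hv => ht v (Or.inr (Or.inl hv))
      simpa [hw] using hl
    · right
      refine iht _ ?_ fun v hv => ht v (Or.inr (Or.inr hv))
      simpa [hw] using hl

end Refutation

end Words

/-! ### The two certificates. -/

/-- Refutes a positive cone on the words whose exponent sum in `b` is divisible by 5. -/
def firstRefutation : Refutation :=
  .split [a]
    (.split [A,A] (.product [[A,A], [a], [a]] []) <|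
      .split [A,b,A,B]
        (.split [b,a,B] (.product [[A,b,A,B], [b,a,B], [a]] []) <|
          .split [b,a,a,B] (.product [[b,a,a,B], [b,A,B], [b,A,B]] []) <|
          .split [b,A,b,A,B,a,B] (.product [[b,A,A,B], [A,b,A,B], [b,A,b,A,B,a,B]] [(2,21)]) <|
          .split [b,b,A,B,a,B] (.product [[b,A,b,a,B,a,B], [b,A,B], [b,b,A,B,a,B]] []) <|
          .split [a,B,A,A,b] (.product [[b,A,b,a,B,a,B], [b,A,b,a,B,B], [a,B,A,A,b]] [(4,0), (0,11)]) <|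
          .split [B,A,b]
            (.split [a,B,A,b] (.product [[a,B,A,b], [B,A,b], [B,a,a,b,A]] []) <|
              .product [[a], [B,A,b], [B,a,b,A]] []) <|
          .split [A,B,A,b] (.product [[a], [A,B,A,b], [B,a,b]] []) <|
          .split [a,b,a,B] (.product [[a,b,a,B], [a,a], [B,a,b]] [(0,34)]) <|
          .split [a,B,B,a,b,b] (.product [[B,a,b,a], [B,a,a,b,A], [a,B,B,a,b,b]] [(1,34)]) <|
          .split [B,a,B,B,B,a,B] (.product [[B,a,B,B,B,a,B], [b,A,b,a,B,B], [b,A,B,A]] [(0,1)]) <|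
          .split [a,B,B,a,b,A,b] (.product [[B,B,A,b,b,A], [a,B,B,a,b,A,b], [B,a,b]] []) <|
          .product [[A,b,A,B], [b,A,b,b,b,A,b], [B,a,B,A,b,b,A]] [(5,14), (0,19)]) <|
      .split [B,a,b,a] (.product [[b,a,B,a], [a], [B,a,b,a]] [(0,33)]) <|
      .split [B,a,b] (.product [[a], [A,B,A,b], [B,a,b]] []) <|
      .split [B,a,b,A] (.product [[a], [B,A,b], [B,a,b,A]] []) <|
      .split [B,a,a,b,A] (.product [[a,B,A,b], [B,A,b], [B,a,a,b,A]] []) <|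
      .split [B,B,A,b,b,A] (.product [[B,B,A,b,b,A], [a,B,A,A,b], [A,B,A,b]] [(1,20)]) <|
      .split [B,a,B,A,b,b,A] (.product [[B,A,b], [B,a,B,A,b,b,A], [a,B,B,a,b,b]] []) <|
      .split [B,a,B,B,B,a,B] (.product [[a,B,B,a,b,A,b], [B,a,B,B,B,a,B], [b,a,B,a]] [(5,31), (0,0)]) <|
      .split [b,A,A,B] (.product [[b,A,A,B], [a,B,A,A,b], [b,A,b,b,b,A,b]] [(7,13), (3,7), (0,18), (0,17)]) <|
      .split [b,A,B] (.product [[b,a,a,B], [b,A,B], [b,A,B]] []) <|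
      .split [b,A,B,A] (.product [[a], [b,a,B], [b,A,B,A]] []) <|
      .split [b,A,b,a,B,a,B] (.product [[b,a,a,B], [b,A,b,a,B,a,B], [b,a,B,a]] [(0,35)]) <|
      .split [b,b,A,B,a,B] (.product [[b,A,b,b,b,A,b], [a,b,a,B], [b,b,A,B,a,B]] [(3,12)]) <|
      .product [[b,A,b,a,B,B], [b,a,B], [b,A,b,A,B,a,B]] []) <|
  .split [a,a] (.product [[A], [a,a], [A]] []) <|
  .split [A,b,A,B]
    (.split [A,B,A,b] (.product [[A,b,A,B], [A,B,A,b], [A]] [(0,25)]) <|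
      .split [B,A,b] (.product [[A], [B,A,b], [B,a,b,a]] []) <|
      .split [a,B,A,b] (.product [[A], [a,B,A,b], [B,a,b]] []) <|
      .split [a,B,A,A,b] (.product [[a,B,A,A,b], [B,a,b], [B,a,b,A]] []) <|
      .split [a,B,B,a,b,b] (.product [[B,a,b,a], [B,a,a,b,A], [a,B,B,a,b,b]] [(1,34)]) <|
      .split [a,B,B,a,b,A,b] (.product [[B,B,A,b,b,A], [a,B,B,a,b,A,b], [B,a,b]] []) <|
      .split [b,A,b,b,b,A,b] (.product [[A,b,A,B], [b,A,b,b,b,A,b], [B,a,B,A,b,b,A]] [(5,14), (0,19)]) <|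
      .split [b,a,a,B] (.product [[b,a,a,B], [B,a,B,B,B,a,B], [B,a,a,b,A]] [(8,1), (7,28), (2,0), (0,9)]) <|
      .split [b,A,b,A,B,a,B] (.product [[b,A,A,B], [A,b,A,B], [b,A,b,A,B,a,B]] [(2,21)]) <|
      .split [b,a,B] (.product [[b,a,B], [b,A,A,B], [b,a,B]] []) <|
      .split [b,b,A,B,a,B] (.product [[b,A,b,a,B,a,B], [b,A,B], [b,b,A,B,a,B]] []) <|
      .split [b,A,B,A] (.product [[B,a,B,B,B,a,B], [b,A,b,a,B,B], [b,A,B,A]] [(0,1)]) <|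
      .product [[A], [a,b,a,B], [b,A,B]] []) <|
  .split [b,A,B] (.product [[b,a,B,a], [A], [b,A,B]] []) <|
  .split [b,A,A,B] (.product [[b,a,B], [b,A,A,B], [b,a,B]] []) <|
  .split [b,A,b,a,B,a,B] (.product [[b,a,a,B], [b,A,b,a,B,a,B], [b,a,B,a]] [(0,35)]) <|
  .split [b,A,b,a,B,B] (.product [[b,A,b,a,B,B], [b,a,B], [b,A,b,A,B,a,B]] []) <|
  .split [B,a,a,b,A] (.product [[b,A,b,A,B,a,B], [B,a,a,b,A], [b,b,A,B,a,B]] [(9,15), (3,2)]) <|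
  .split [B,A,b]
    (.split [b,A,B,A] (.product [[B,A,b], [A,A], [b,A,B,A]] [(0,20)]) <|
      .split [B,a,b,a] (.product [[A], [B,A,b], [B,a,b,a]] []) <|
      .split [B,B,A,b,b,A] (.product [[B,B,A,b,b,A], [a,B,A,A,b], [A,B,A,b]] [(1,20)]) <|
      .split [b,A,b,b,b,A,b] (.product [[b,A,b,b,b,A,b], [a,b,a,B], [b,b,A,B,a,B]] [(3,12)]) <|
      .split [a,B,B,a,b,A,b] (.product [[a,B,B,a,b,A,b], [B,a,B,B,B,a,B], [b,a,B,a]] [(5,31), (0,0)]) <|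
      .product [[B,A,b], [B,a,B,A,b,b,A], [a,B,B,a,b,b]] []) <|
  .split [B,a,b,A] (.product [[a,B,A,A,b], [B,a,b], [B,a,b,A]] []) <|
  .product [[A], [a,B,A,b], [B,a,b]] []

/-- Refutes a positive cone on the words whose exponent sum in `a` plus twice that in `b` is divisible
by 5. -/
def secondRefutation : Refutation :=
  .split [A,b,A]
    (.split [B,A,B] (.product [[A,b,A], [B,A,B], [A,b,A]] [(0,25)]) <|
      .split [A,A,b]
        (.split [b,A,b,b] (.product [[A,A,b], [b,A,b,b], [A,A,b]] [(3,14), (0,26)]) <|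
          .split [B,A,A,b,b] (.product [[B,A,A,b,b], [B,B,a,B], [b,a,b]] []) <|
          .split [B,B,a,b,a] (.product [[B,B,a,b,a], [b,a,b], [B,B,a,a,b]] [(1,28)]) <|
          .split [b,a,B,B,a] (.product [[B,B,a,B], [b,a,B,B,a], [B,B,a,a,b]] [(5,1), (1,31)]) <|
          .split [b,b,a] (.product [[B,B,a,B], [b,b,a], [A,B,A,b,b]] []) <|
          .split [b,b,b,A] (.product [[A,b,A], [A,b,b,A,B], [b,b,b,A]] [(5,14), (0,19)]) <|
          .split [b,a,a,B,B] (.product [[b,a,a,B,B], [a,B,B,B], [b,a,a,B,B]] [(4,1), (1,30)]) <|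
          .split [B,A,b,b,A] (.product [[a,B,B,B], [b,a,b], [B,A,b,b,A]] []) <|
          .split [B,a,b,A] (.product [[a,B,B,a,b], [B,a,b,A], [b,b,A,A,B]] [(4,15), (0,0)]) <|
          .split [A,B,A,A] (.product [[A,B,A,A], [a,B,A,b], [A,A,b]] [(0,23)]) <|
          .split [B,B,A] (.product [[B,B,A], [a,a,b,a], [A,B,A,b,b]] []) <|
          .split [b,A,A] (.product [[B,B,a,B], [b,A,A], [a,b,b]] []) <|
          .split [A,A,b,b,A,A] (.product [[A,A,b], [A,A,b,b,A,A], [a,b,b]] [(4,13), (0,26)]) <|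
          .product [[A,B,B], [a,a,B], [a,a,B,B,a,a]] [(2,31), (1,5)]) <|
      .split [a,B,A,b] (.product [[A,b,A], [a,B,A,b], [B,a,a]] []) <|
      .split [B,B,a,B] (.product [[B,B,a,B], [B,a,a], [B,a,a]] [(4,31), (0,8)]) <|
      .split [a,B,B,a,b]
        (.split [B,A,b,A,b] (.product [[a,B,B,a,b], [B,A,b,A,b], [B,a,b,A]] []) <|
          .split [b,b,A,A,B] (.product [[a,B,B,a,b], [B,a,b,A], [b,b,A,A,B]] [(4,15), (0,0)]) <|
          .split [A,A,A,b,b,A] (.product [[A,A,A,b,b,A], [a,B,B,a,b], [B,a,a]] []) <|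
          .split [a,b,b] (.product [[a,b,b], [B,a,B,a,b], [B,a,B,a,b]] [(0,34)]) <|
          .split [a,a,B,B,a,a] (.product [[B,a,a], [B,B,A], [a,a,B,B,a,a]] [(4,1), (0,31)]) <|
          .split [A,B,B] (.product [[A,B,B], [b,a,a,B,B], [a,B,B,a,a,a]] [(5,1), (1,31)]) <|
          .split [b,A,A] (.product [[A,A,b,b,A,A], [b,A,A], [b,b,a]] [(3,18), (1,10)]) <|
          .product [[A,A,b,b,A,A], [a,a,B], [B,a,a]] []) <|
      .split [b,a,b,a,a,B] (.product [[b,a,b,a,a,B], [b,A,b,b], [B,A,b,b,A]] [(0,9)]) <|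
      .split [A,b,a,B] (.product [[A,b,A], [A,b,a,B], [b,A,A,B,A,B]] [(0,19)]) <|
      .split [a,b,b] (.product [[b,a,b], [a,b,b], [B,A,b,b,A]] [(0,9)]) <|
      .split [a,B,B,B] (.product [[a,B,B,B], [b,a,b], [B,A,b,b,A]] []) <|
      .split [a,a,B,B,a,a] (.product [[B,a,a], [B,B,A], [a,a,B,B,a,a]] [(4,1), (0,31)]) <|
      .split [b,b,A,A,B] (.product [[b,b,b,A], [b,b,A,A,B], [b,b,A,A,B]] [(2,14), (1,24)]) <|
      .split [a,a,B] (.product [[A,A,b,b,A,A], [a,a,B], [B,a,a]] []) <|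
      .split [b,b,a] (.product [[A,A,b,b,A,A], [b,A,A], [b,b,a]] [(3,18), (1,10)]) <|
      .split [A,A,B,A] (.product [[A,A,B,A], [b,A,A], [b,A,B,a]] [(1,21)]) <|
      .split [A,A,A,b,b,A] (.product [[A,A,A,b,b,A], [b,a,b], [a,b,a,a]] [(2,13)]) <|
      .product [[A,B,B], [b,a,a,B,B], [a,B,B,a,a,a]] [(5,1), (1,31)]) <|
  .split [b,a,b] (.product [[b,a,b], [a,B,a], [a,B,a]] [(0,35)]) <|
  .split [A,A,b]
    (.split [B,a,b,A] (.product [[a,B,a], [A,A,b], [B,a,b,A]] []) <|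
      .split [b,A,b,b] (.product [[A,A,b], [b,A,b,b], [A,A,b]] [(3,14), (0,26)]) <|
      .split [a,B,B,a,b]
        (.split [b,b,b,A] (.product [[a,B,B,a,b], [B,A,B], [b,b,b,A]] []) <|
          .split [b,a,a,B,B] (.product [[b,a,a,B,B], [a,B,B,B], [b,a,a,B,B]] [(4,1), (1,30)]) <|
          .split [B,B,A] (.product [[a,B,B,a,b], [B,B,A], [B,A,B]] [(0,0)]) <|
          .split [b,A,A] (.product [[B,B,a,B], [b,A,A], [a,b,b]] []) <|
          .split [b,A,A,B,A,B] (.product [[a,B,B,a,b], [B,B,a,B], [b,A,A,B,A,B]] [(0,0)]) <|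
          .split [A,A,b,b,A,A] (.product [[A,A,b], [A,A,b,b,A,A], [a,b,b]] [(4,13), (0,26)]) <|
          .split [b,A,B,a] (.product [[a,B,a], [b,a,b,a,a,B], [b,A,B,a]] [(0,29)]) <|
          .split [A,B,B] (.product [[A,B,B], [a,a,B], [a,a,B,B,a,a]] [(2,31), (1,5)]) <|
          .split [a,b,a,a] (.product [[A,b,a,B], [a,a,B], [a,b,a,a]] [(1,33)]) <|
          .split [A,A,A,b,b,A] (.product [[b,b,a], [A,A,A,b,b,A], [b,b,A,A,B]] [(5,14), (1,18)]) <|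
          .product [[A,A,B,A], [B,A,B], [a,B,B,a,a,a]] [(2,5)]) <|
      .split [b,a,a,B,B] (.product [[b,a,a,B,B], [a,B,A,b], [B,A,b,b,A]] [(2,0), (0,9)]) <|
      .split [B,a,B,a,b] (.product [[a,B,A,b], [B,a,B,a,b], [B,A,b,b,A]] []) <|
      .split [a,B,B,a,a,a] (.product [[A,A,b], [B,A,b,b,A], [a,B,B,a,a,a]] []) <|
      .split [b,b,a] (.product [[b,b,a], [A,A,A,b,b,A], [b,b,A,A,B]] [(5,14), (1,18)]) <|
      .split [B,B,A] (.product [[B,A,b,A,b], [B,B,A], [B,A,b,A,b]] [(1,25)]) <|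
      .split [b,A,A] (.product [[B,B,a,B], [b,A,A], [a,b,b]] []) <|
      .split [A,A,b,b,A,A] (.product [[A,A,b], [A,A,b,b,A,A], [a,b,b]] [(4,13), (0,26)]) <|
      .product [[A,B,B], [a,a,B], [a,a,B,B,a,a]] [(2,31), (1,5)]) <|
  .split [B,B,a,B] (.product [[B,B,a,B], [B,a,a], [B,a,a]] [(4,31), (0,8)]) <|
  .split [B,B,a,a,b] (.product [[B,A,B], [b,A,b,b], [B,B,a,a,b]] []) <|
  .split [A,B,A,b,b] (.product [[B,A,A,b,b], [B,A,B], [A,B,A,b,b]] [(1,26)]) <|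
  .split [A,b,b,A,B] (.product [[b,A,b,b], [B,A,A,b,b], [A,b,b,A,B]] [(6,14), (1,19)]) <|
  .split [a,B,B,B] (.product [[a,B,B,B], [b,a,B,B,a], [a,B,a]] [(5,31), (0,0)]) <|
  .split [b,b,A,A,B] (.product [[b,b,b,A], [b,b,A,A,B], [b,b,A,A,B]] [(2,14), (1,24)]) <|
  .split [a,B,B,a,b] (.product [[a,B,B,a,b], [B,A,B], [b,b,b,A]] []) <|
  .split [a,B,A,b] (.product [[b,a,a,B,B], [a,B,A,b], [B,A,b,b,A]] [(2,0), (0,9)]) <|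
  .split [a,a,b,a] (.product [[B,a,a], [B,a,b,A], [a,a,b,a]] [(0,31)]) <|
  .split [A,A,A,b,b,A] (.product [[A,A,A,b,b,A], [b,a,a,B,B], [a,B,a]] [(2,13), (1,4)]) <|
  .split [a,b,b] (.product [[B,B,a,b,a], [A,B,A,A], [a,b,b]] []) <|
  .split [a,a,B,B,a,a] (.product [[B,a,a], [B,B,A], [a,a,B,B,a,a]] [(4,1), (0,31)]) <|
  .split [A,B,B] (.product [[A,B,B], [b,a,a,B,B], [a,B,B,a,a,a]] [(5,1), (1,31)]) <|
  .split [b,A,A] (.product [[A,A,b,b,A,A], [b,A,A], [b,b,a]] [(3,18), (1,10)]) <|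
  .product [[A,A,b,b,A,A], [a,a,B], [B,a,a]] []

/-! ### Kernels of characters to `ℤ/5` are not left-orderable. -/

section WeeksGroup

open WeeksWord

namespace WeeksGroup

/-- The generator `a` of the Weeks group. -/
def genA : WeeksGroup := PresentedGroup.of 0

/-- The generator `b` of the Weeks group. -/
def genB : WeeksGroup := PresentedGroup.of 1

theorem weeksPair : WeeksPair genA genB := by
  constructor
  · have h : PresentedGroup.mk weeksRelators _ = 1 :=
      PresentedGroup.one_of_mem (Set.mem_insert _ _)
    simpa [genA, genB, PresentedGroup.of, firstRelator, WeeksLetter.eval, pow_two, mul_assoc]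
      using h
  · have h : PresentedGroup.mk weeksRelators _ = 1 :=
      PresentedGroup.one_of_mem (Set.mem_insert_of_mem _ rfl)
    simpa [genA, genB, PresentedGroup.of, secondRelator, WeeksLetter.eval, pow_two, mul_assoc]
      using h

/-- A homomorphism from the Weeks group given by a pair satisfying its relations. -/
def lift {H : Type*} [Group H] {x y : H} (h : WeeksPair x y) : WeeksGroup →* H :=
  PresentedGroup.toGroup (f := ![x, y]) <| by
    have h1 := h.first
    have h2 := h.second
    simp only [firstRelator, secondRelator, eval_cons, eval_nil, WeeksLetter.eval] at h1 h2
    rintro r (rfl | rfl)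
    · simpa [pow_two, mul_assoc] using h1
    · simpa [pow_two, mul_assoc] using h2

@[simp]
theorem lift_genA {H : Type*} [Group H] {x y : H} (h : WeeksPair x y) : lift h genA = x := by
  simp [lift, genA]

@[simp]
theorem lift_genB {H : Type*} [Group H] {x y : H} (h : WeeksPair x y) : lift h genB = y := by
  simp [lift, genB]

/-- A fractional linear permutation of order 7 of the projective line over the field with seven
elements, the image of `a`. -/
def permA : Equiv.Perm (Fin 8) where
  toFun := ![7, 2, 6, 5, 1, 0, 4, 3]
  invFun := ![5, 4, 1, 7, 6, 3, 2, 0]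
  left_inv := by decide
  right_inv := by decide

/-- The image of `b` in the permutations of the projective line over the field with seven
elements. -/
def permB : Equiv.Perm (Fin 8) where
  toFun := ![2, 5, 4, 1, 7, 6, 3, 0]
  invFun := ![7, 3, 0, 6, 2, 1, 5, 4]
  left_inv := by decide
  right_inv := by decide

theorem weeksPair_perm : WeeksPair permA permB := by
  constructor <;> ext i <;> revert i <;> decide

/-- Exchanging `a` and `b` exchanges the two relators. -/
theorem _root_.WeeksPair.swap {H : Type*} [Group H] {x y : H} (h : WeeksPair x y) :
    WeeksPair y x := by
  have h1 := h.first
  have h2 := h.second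
  simp only [firstRelator, secondRelator, eval_cons, eval_nil, WeeksLetter.eval] at h1 h2
  constructor
  · simpa [firstRelator, WeeksLetter.eval] using h2
  · simpa [secondRelator, WeeksLetter.eval] using h1

/-- On the ratio `r = χ(b)/χ(a)` in the projective line over `𝔽₅`, this substitution acts by `r ↦ 1
- r` and the swap by `r ↦ 1/r`. The orbits are `{0, 1, ∞}` and `{2, 3, 4}`, so two refutations
suffice. -/
theorem _root_.WeeksPair.twist {H : Type*} [Group H] {x y : H} (h : WeeksPair x y) :
    WeeksPair x (y⁻¹ * x) := by
  constructor
  · have h1 := h.eval_eq_one_of_trivialBy [(0,31),(0,4)]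
      [B, a, a, B, a, a, B, a, A, B, a, B, a, A] (by decide)
    simpa [firstRelator, WeeksLetter.eval, mul_assoc] using h1
  · have h1 := h.eval_eq_one_of_trivialBy [(0,32)]
      [a, B, a, a, B, a, a, A, b, a, a, A, b] (by decide)
    simpa [secondRelator, WeeksLetter.eval, mul_assoc] using h1

/-- Totality applies only to nontrivial elements of the kernel. The degree 8 permutation
representation certifies that the words split upon are nontrivial. -/
theorem not_total_of_refutation {x y : WeeksGroup} (h : WeeksPair x y)
    (χ : WeeksGroup →* Multiplicative (ZMod 5)) (P : Subsemigroup WeeksGroup)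
    (hP : (1 : WeeksGroup) ∉ P) (htot : ∀ g, χ g = 1 → g ≠ 1 → g ∈ P ∨ g⁻¹ ∈ P)
    (t : Refutation) (ht : t.check [] = true)
    (hker : ∀ w ∈ t.words, eval (χ x) (χ y) w = 1)
    (hne : ∀ w ∈ t.words, eval (lift weeksPair_perm x) (lift weeksPair_perm y) w ≠ 1) :
    False := by
  refine absurd (t.not_total h P hP [] (by simp) fun w hw => htot _ ?_ fun h1 => hne w hw ?_)
    (by simp [ht])
  · rw [map_eval, hker w hw]
  · rw [← map_eval, h1, map_one]

set_option maxRecDepth 100000 in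
/-- The kernel of a homomorphism from the Weeks group to the cyclic group of order 5 is not
left-orderable. -/
theorem not_total_on_ker (χ : WeeksGroup →* Multiplicative (ZMod 5))
    (P : Subsemigroup WeeksGroup) (hP : (1 : WeeksGroup) ∉ P)
    (htot : ∀ g, χ g = 1 → g ≠ 1 → g ∈ P ∨ g⁻¹ ∈ P) : False := by
  have c₁ : firstRefutation.check [] = true := by decide +kernel
  have c₂ : secondRefutation.check [] = true := by decide +kernel
  have k₁ : ∀ s : Multiplicative (ZMod 5), ∀ w ∈ firstRefutation.words, eval 1 s w = 1 := by
    decide +kernel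
  have k₂ : ∀ s : Multiplicative (ZMod 5), ∀ w ∈ secondRefutation.words,
      eval s (s * s) w = 1 := by
    decide +kernel
  -- These are the six lines through the origin in `(ℤ/5)²`; the trivial character lies on all of
  -- them.
  have lines : ∀ s t : Multiplicative (ZMod 5),
      s = 1 ∨ t = 1 ∨ t⁻¹ * s = 1 ∨ t = s * s ∨ s = t * t ∨ t⁻¹ * s = s * s := by
    decide +kernel
  have hab := weeksPair
  rcases lines (χ genA) (χ genB) with h | h | h | h | h | h
  · refine not_total_of_refutation hab χ P hP htot _ c₁ ?_ ?_
    · rw [h]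
      exact k₁ _
    · rw [lift_genA, lift_genB]
      decide +kernel
  · refine not_total_of_refutation hab.swap χ P hP htot _ c₁ ?_ ?_
    · rw [h]
      exact k₁ _
    · rw [lift_genA, lift_genB]
      decide +kernel
  · refine not_total_of_refutation hab.twist.swap χ P hP htot _ c₁ ?_ ?_
    · rw [map_mul, map_inv, h]
      exact k₁ _
    · rw [map_mul, map_inv, lift_genA, lift_genB]
      decide +kernel
  · refine not_total_of_refutation hab χ P hP htot _ c₂ ?_ ?_
    · rw [h]
      exact k₂ _
    · rw [lift_genA, lift_genB]
      decide +kernel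
  · refine not_total_of_refutation hab.swap χ P hP htot _ c₂ ?_ ?_
    · rw [h]
      exact k₂ _
    · rw [lift_genA, lift_genB]
      decide +kernel
  · refine not_total_of_refutation hab.twist χ P hP htot _ c₂ ?_ ?_
    · rw [map_mul, map_inv, h]
      exact k₂ _
    · rw [map_mul, map_inv, lift_genA, lift_genB]
      decide +kernel

end WeeksGroup

end WeeksGroup

/-! ### A left order and the orientation character on homeomorphisms of the line. -/

section RealLine

/-- The positive cone of a left order on the orientation-preserving homeomorphisms of the line:
the first moved point, with respect to a well-ordering of the line, is moved to the right. -/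
def positiveHomeomorph : Subsemigroup (ℝ ≃ₜ ℝ) where
  carrier := {f | StrictMono f ∧ ∃ x, x < f x ∧ ∀ y, WellOrderingRel y x → f y = y}
  mul_mem' := by
    rintro f g ⟨hf, x, hx, hfx⟩ ⟨hg, y, hy, hgy⟩
    refine ⟨hf.comp hg, ?_⟩
    -- The first point moved by the product is the earlier of the first points moved by the factors.
    rcases trichotomous_of WellOrderingRel x y with h | rfl | h
    · refine ⟨x, ?_, fun z hz => ?_⟩
      · rwa [Homeomorph.mul_apply, hgy x h]
      · rw [Homeomorph.mul_apply, hgy z (_root_.trans hz h), hfx z hz]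
    · refine ⟨x, hx.trans (hf hy), fun z hz => ?_⟩
      rw [Homeomorph.mul_apply, hgy z hz, hfx z hz]
    · refine ⟨y, ?_, fun z hz => ?_⟩
      · rw [Homeomorph.mul_apply]
        simpa [hfx y h] using hf hy
      · rw [Homeomorph.mul_apply, hgy z hz, hfx z (_root_.trans hz h)]

theorem one_notMem_positiveHomeomorph : (1 : ℝ ≃ₜ ℝ) ∉ positiveHomeomorph := by
  rintro ⟨-, x, hx, -⟩
  exact lt_irrefl _ hx

theorem StrictMono.homeomorph_inv {f : ℝ ≃ₜ ℝ} (hf : StrictMono f) :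
    StrictMono (f⁻¹ : ℝ ≃ₜ ℝ) := by
  intro x y hxy
  rw [← hf.lt_iff_lt]
  simpa [Homeomorph.inv_apply] using hxy

theorem positiveHomeomorph_or {f : ℝ ≃ₜ ℝ} (hf : StrictMono f) (h1 : f ≠ 1) :
    f ∈ positiveHomeomorph ∨ f⁻¹ ∈ positiveHomeomorph := by
  have hne : {x | f x ≠ x}.Nonempty := by
    by_contra h
    refine h1 (Homeomorph.ext fun x => ?_)
    by_contra hx
    exact h ⟨x, hx⟩
  have wf : WellFounded (WellOrderingRel : ℝ → ℝ → Prop) := WellOrderingRel.isWellOrder.wf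
  set x := wf.min _ hne
  have hx : f x ≠ x := wf.min_mem _ hne
  have hmin : ∀ y, WellOrderingRel y x → f y = y := by
    intro y hy
    by_contra h
    exact wf.not_lt_min _ h hy
  rcases lt_or_gt_of_ne hx with h | h
  · refine Or.inr ⟨hf.homeomorph_inv, x, ?_, fun y hy => ?_⟩
    · rw [← hf.lt_iff_lt]
      simpa [Homeomorph.inv_apply] using h
    · rw [Homeomorph.inv_apply, Homeomorph.symm_apply_eq, hmin y hy]
  · exact Or.inl ⟨hf, x, h, hmin⟩

open Classical in
/-- The orientation character of the homeomorphism group of the line. -/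
noncomputable def orientation : (ℝ ≃ₜ ℝ) →* ℤˣ where
  toFun f := if StrictMono f then 1 else -1
  map_one' := if_pos strictMono_id
  map_mul' f g := by
    have anti : ∀ h : ℝ ≃ₜ ℝ, ¬ StrictMono h → StrictAnti h := fun h hh =>
      (h.continuous.strictMono_of_inj h.injective).resolve_left hh
    have notMono : ∀ h : ℝ ≃ₜ ℝ, StrictAnti h → ¬ StrictMono h := fun h h1 h2 =>
      lt_asymm (h1 zero_lt_one) (h2 zero_lt_one)
    by_cases hf : StrictMono f <;> by_cases hg : StrictMono g
    · have h : StrictMono (f * g) := hf.comp hg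
      simp [hf, hg, h]
    · have h : StrictAnti (f * g) := hf.comp_strictAnti (anti g hg)
      simp [hf, hg, notMono _ h]
    · have h : StrictAnti (f * g) := (anti f hf).comp_strictMono hg
      simp [hf, hg, notMono _ h]
    · have h : StrictMono (f * g) := (anti f hf).comp (anti g hg)
      simp [hf, hg, h]

theorem orientation_eq_one_iff {f : ℝ ≃ₜ ℝ} : orientation f = 1 ↔ StrictMono f := by
  classical
  change (if StrictMono f then (1 : ℤˣ) else -1) = 1 ↔ _
  split_ifs with h <;> simp [h]

end RealLine

/-! ### Lifting circle homeomorphisms to the line. -/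

section CircleLifts

open Real

/-- Translation of the line by one turn. -/
noncomputable def turn : ℝ ≃ₜ ℝ := Homeomorph.addRight (2 * π)

theorem turn_zpow_apply (n : ℤ) (x : ℝ) : (turn ^ n) x = x + n * (2 * π) := by
  induction n using Int.induction_on generalizing x with
  | zero => simp
  | succ n ih =>
    rw [zpow_add_one, Homeomorph.mul_apply, ih]
    simp [turn]
    ring
  | pred n ih =>
    have h : turn⁻¹ x = x - 2 * π := by
      rw [Homeomorph.inv_apply, Homeomorph.symm_apply_eq]
      simp [turn]
    rw [zpow_sub_one, Homeomorph.mul_apply, ih, h]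
    push_cast
    ring

theorem turn_zpow_injective : Function.Injective (fun n : ℤ => turn ^ n) := by
  intro m n h
  have h0 := congrArg (fun f : ℝ ≃ₜ ℝ => f 0) h
  simpa [turn_zpow_apply, pi_ne_zero] using h0

theorem strictMono_turn_zpow (n : ℤ) : StrictMono (turn ^ n) := by
  intro x y h
  simpa [turn_zpow_apply] using h

/-- `F` is a lift of the circle homeomorphism `f` to the line. -/
def IsCircleLift (f : Circle ≃ₜ Circle) (F : ℝ ≃ₜ ℝ) : Prop :=
  ∀ x, Circle.exp (F x) = f (Circle.exp x)

theorem IsCircleLift.one : IsCircleLift 1 1 := fun _ => rfl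

theorem IsCircleLift.mul {f g : Circle ≃ₜ Circle} {F G : ℝ ≃ₜ ℝ} (hf : IsCircleLift f F)
    (hg : IsCircleLift g G) : IsCircleLift (f * g) (F * G) := fun x => by
  rw [Homeomorph.mul_apply, Homeomorph.mul_apply, hf, hg]

theorem IsCircleLift.inv {f : Circle ≃ₜ Circle} {F : ℝ ≃ₜ ℝ} (hf : IsCircleLift f F) :
    IsCircleLift f⁻¹ F⁻¹ := fun x => by
  rw [Homeomorph.inv_apply, Homeomorph.inv_apply, eq_comm, Homeomorph.symm_apply_eq, ← hf,
    Homeomorph.apply_symm_apply]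

theorem isCircleLift_turn : IsCircleLift 1 turn := fun x => Circle.periodic_exp x

theorem eq_of_exp_comp_eq {F G : ℝ → ℝ} (hF : Continuous F) (hG : Continuous G)
    (h : ∀ x, Circle.exp (F x) = Circle.exp (G x)) (x : ℝ) (hx : F x = G x) : F = G :=
  Circle.isCoveringMap_exp.eq_of_comp_eq hF hG (funext h) x hx

theorem IsCircleLift.eq_turn_zpow {F : ℝ ≃ₜ ℝ} (h : IsCircleLift 1 F) :
    ∃ n : ℤ, F = turn ^ n := by
  obtain ⟨n, hn⟩ := Circle.exp_eq_exp.1 (h 0)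
  refine ⟨n, DFunLike.coe_injective
    (eq_of_exp_comp_eq F.continuous (turn ^ n).continuous (fun x => ?_) 0 ?_)⟩
  · rw [turn_zpow_apply]
    exact (h x).trans (Circle.exp_eq_exp.2 ⟨-n, by push_cast; ring⟩)
  · rw [hn, turn_zpow_apply]

theorem IsCircleLift.eq_one_of_turn_zpow {f : Circle ≃ₜ Circle} {n : ℤ}
    (h : IsCircleLift f (turn ^ n)) : f = 1 := by
  ext1 z
  obtain ⟨x, rfl⟩ := Circle.exp_surjective z
  rw [← h x, turn_zpow_apply]
  exact Circle.exp_eq_exp.2 ⟨n, rfl⟩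

/-- Lift both `f` and its inverse through the covering, with matching base points; uniqueness of
lifts makes the two lifts mutually inverse. -/
theorem exists_isCircleLift (f : Circle ≃ₜ Circle) : ∃ F : ℝ ≃ₜ ℝ, IsCircleLift f F := by
  have key : ∀ (g : Circle ≃ₜ Circle) (x y : ℝ), Circle.exp y = g (Circle.exp x) →
      ∃ F : C(ℝ, ℝ), F x = y ∧ ∀ t, Circle.exp (F t) = g (Circle.exp t) := by
    intro g x y h
    obtain ⟨F, ⟨hF, hF'⟩, -⟩ := Circle.isCoveringMap_exp.existsUnique_continuousMap_lifts
      ((g : C(Circle, Circle)).comp Circle.exp) x y h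
    exact ⟨F, hF, fun t => congrFun hF' t⟩
  obtain ⟨y, hy⟩ := Circle.exp_surjective (f (Circle.exp 0))
  obtain ⟨F, hF, hF'⟩ := key f 0 y hy
  obtain ⟨G, hG, hG'⟩ := key f.symm y 0 (by rw [hy, Homeomorph.symm_apply_apply])
  have h1 : G ∘ F = id := by
    refine eq_of_exp_comp_eq (G.continuous.comp F.continuous) continuous_id (fun x => ?_) 0 ?_
    · simp [hG', hF']
    · simp [hF, hG]
  have h2 : F ∘ G = id := by
    refine eq_of_exp_comp_eq (F.continuous.comp G.continuous) continuous_id (fun x => ?_) y ?_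
    · simp [hG', hF']
    · simp [hF, hG]
  exact ⟨⟨⟨F, G, congrFun h1, congrFun h2⟩, F.continuous, G.continuous⟩, hF'⟩

/-- Conjugating `turn` by `F` or `F⁻¹` gives lifts of the identity, hence powers `m` and `n` of
`turn` with `m * n = 1`. Monotonicity excludes `m = -1`. -/
theorem IsCircleLift.commute_turn {f : Circle ≃ₜ Circle} {F : ℝ ≃ₜ ℝ} (h : IsCircleLift f F)
    (hF : StrictMono F) : Commute F turn := by
  obtain ⟨m, hm⟩ := IsCircleLift.eq_turn_zpow (F := F * turn * F⁻¹) <| by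
    simpa using (h.mul isCircleLift_turn).mul h.inv
  obtain ⟨n, hn⟩ := IsCircleLift.eq_turn_zpow (F := F⁻¹ * turn * F) <| by
    simpa using (h.inv.mul isCircleLift_turn).mul h
  have h1 : turn ^ (m * n) = turn ^ (1 : ℤ) := by
    rw [zpow_mul, ← hm, conj_zpow, ← hn]
    group
  have hmn : m * n = 1 := turn_zpow_injective h1
  have hpos : 0 < m := by
    have hlt : F 0 < F (turn 0) := hF (by simp [turn, pi_pos])
    have he : F (turn 0) = (turn ^ m) (F 0) := by
      rw [← hm]
      simp [Homeomorph.mul_apply, Homeomorph.inv_apply]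
    rw [he, turn_zpow_apply] at hlt
    have h2 : 0 < (m : ℝ) * (2 * π) := by linarith
    exact_mod_cast pos_of_mul_pos_left h2 two_pi_pos.le
  have hm1 : m = 1 := by
    rcases Int.eq_one_or_neg_one_of_mul_eq_one hmn with h | h <;> omega
  rw [hm1, zpow_one, mul_inv_eq_iff_eq_mul] at hm
  exact hm

end CircleLifts

/-! ### Orientation and Euler class from the relators. -/

section Action

open WeeksWord

theorem strictMono_of_relators {F G : ℝ ≃ₜ ℝ} {m n : ℤ} (h₁ : eval F G firstRelator = turn ^ m)
    (h₂ : eval F G secondRelator = turn ^ n) : StrictMono F ∧ StrictMono G := by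
  -- The relators impose `t ^ 5 = 1` and `s ^ 5 = 1`, and 5 is odd.
  have key : ∀ s t : ℤˣ, eval s t firstRelator = 1 → eval s t secondRelator = 1 →
      s = 1 ∧ t = 1 := by decide
  have h := fun k => orientation_eq_one_iff.2 (strictMono_turn_zpow k)
  rw [← orientation_eq_one_iff, ← orientation_eq_one_iff]
  apply key
  · rw [← map_eval, h₁, h]
  · rw [← map_eval, h₂, h]

theorem commute_lift_turn {F G : ℝ ≃ₜ ℝ} (hF : Commute F turn) (hG : Commute G turn)
    (w : FreeGroup (Fin 2)) : Commute (FreeGroup.lift ![F, G] w) turn := by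
  induction w using FreeGroup.induction_on with
  | C1 => simp
  | of i => fin_cases i <;> simpa
  | inv_of i h => simpa using h
  | mul x y hx hy => simpa using hx.mul_left hy

theorem strictMono_lift {F G : ℝ ≃ₜ ℝ} (hF : StrictMono F) (hG : StrictMono G)
    (w : FreeGroup (Fin 2)) : StrictMono (FreeGroup.lift ![F, G] w) := by
  rw [← orientation_eq_one_iff] at hF hG ⊢
  induction w using FreeGroup.induction_on with
  | C1 => simp
  | of i => fin_cases i <;> simpa
  | inv_of i h => simpa using h
  | mul x y hx hy => simp [hx, hy]

/-- A word evaluating in the Weeks group to `1` is, when evaluated in lifts of the generators, a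
translation whose length is determined by the exponents of the word. -/
theorem eq_turn_zpow_of_mk_eq_one {F G : ℝ ≃ₜ ℝ} (hF : Commute F turn) (hG : Commute G turn)
    {m n : ℤ} (h₁ : eval F G firstRelator = turn ^ m) (h₂ : eval F G secondRelator = turn ^ n)
    {w : FreeGroup (Fin 2)} (hw : PresentedGroup.mk weeksRelators w = 1) :
    ∃ k : ℤ, FreeGroup.lift ![Multiplicative.ofAdd n, Multiplicative.ofAdd m] w =
      Multiplicative.ofAdd (5 * k) ∧ FreeGroup.lift ![F, G] w = turn ^ k := by
  have hcomm := commute_lift_turn hF hG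
  let N : Subgroup (FreeGroup (Fin 2)) :=
    { carrier := {v | ∃ k : ℤ,
        FreeGroup.lift ![Multiplicative.ofAdd n, Multiplicative.ofAdd m] v =
          Multiplicative.ofAdd (5 * k) ∧ FreeGroup.lift ![F, G] v = turn ^ k}
      one_mem' := ⟨0, by simp, by simp⟩
      mul_mem' := by
        rintro u v ⟨k, hk, hk'⟩ ⟨l, hl, hl'⟩
        exact ⟨k + l, by rw [map_mul, hk, hl, mul_add, ofAdd_add], by
          rw [map_mul, hk', hl', zpow_add]⟩
      inv_mem' := by
        rintro u ⟨k, hk, hk'⟩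
        exact ⟨-k, by rw [map_inv, hk, mul_neg, ofAdd_neg], by rw [map_inv, hk', zpow_neg]⟩ }
  have hN : N.Normal := ⟨by
    rintro v ⟨k, hk, hk'⟩ u
    refine ⟨k, by simp [hk], ?_⟩
    rw [map_mul, map_mul, map_inv, hk', ((hcomm u).zpow_right k).eq, mul_inv_cancel_right]⟩
  have hle : Subgroup.normalClosure weeksRelators ≤ N := by
    apply Subgroup.normalClosure_le_normal
    -- The first relator has exponent sum 5 in `b` and 0 in `a`, the second the reverse; this is why
    -- `a` is sent to `n` and `b` to `m`.
    rintro r (rfl | rfl)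
    · refine ⟨m, ?_, ?_⟩
      · apply Multiplicative.toAdd.injective
        simp
        ring
      · rw [← h₁]
        simp [firstRelator, WeeksLetter.eval, pow_two, mul_assoc]
    · refine ⟨n, ?_, ?_⟩
      · apply Multiplicative.toAdd.injective
        simp
        ring
      · rw [← h₂]
        simp [secondRelator, WeeksLetter.eval, pow_two, mul_assoc]
  exact hle ((QuotientGroup.eq_one_iff w).1 hw)

end Action

/-! ### From a faithful circle action to a left order on a kernel. -/

theorem mainTheorem2 :
    ¬ ∃ ρ : WeeksGroup →* (Circle ≃ₜ Circle), Function.Injective ρ := by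
  rintro ⟨ρ, hρ⟩
  obtain ⟨F, hF⟩ := exists_isCircleLift (ρ WeeksGroup.genA)
  obtain ⟨G, hG⟩ := exists_isCircleLift (ρ WeeksGroup.genB)
  let E : FreeGroup (Fin 2) →* (ℝ ≃ₜ ℝ) := FreeGroup.lift ![F, G]
  have hlift : ∀ w, IsCircleLift (ρ (PresentedGroup.mk weeksRelators w)) (E w) := by
    intro w
    induction w using FreeGroup.induction_on with
    | C1 => simpa using IsCircleLift.one
    | of i =>
      fin_cases i
      · simpa [E, WeeksGroup.genA, PresentedGroup.of] using hF
      · simpa [E, WeeksGroup.genB, PresentedGroup.of] using hG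
    | inv_of i h => simpa using h.inv
    | mul x y hx hy => simpa using hx.mul hy
  have hword : ∀ w : WeeksWord, w.eval WeeksGroup.genA WeeksGroup.genB = 1 →
      ∃ k : ℤ, w.eval F G = turn ^ k := by
    intro w hw
    apply IsCircleLift.eq_turn_zpow
    have h := hlift (w.eval (FreeGroup.of 0) (FreeGroup.of 1))
    have h1 : PresentedGroup.mk weeksRelators (w.eval (FreeGroup.of 0) (FreeGroup.of 1)) = 1 :=
      (WeeksWord.map_eval _ _ _ w).trans hw
    rw [h1, map_one, WeeksWord.map_eval] at h
    simpa [E] using h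
  obtain ⟨m, hm⟩ := hword _ WeeksGroup.weeksPair.first
  obtain ⟨n, hn⟩ := hword _ WeeksGroup.weeksPair.second
  obtain ⟨monoF, monoG⟩ := strictMono_of_relators hm hn
  have commF := hF.commute_turn monoF
  have commG := hG.commute_turn monoG
  let φ : FreeGroup (Fin 2) →* Multiplicative ℤ :=
    FreeGroup.lift ![Multiplicative.ofAdd n, Multiplicative.ofAdd m]
  have pair : ∀ s t : Multiplicative (ZMod 5), WeeksPair s t := by
    have h : ∀ s t : Multiplicative (ZMod 5), WeeksWord.eval s t firstRelator = 1 ∧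
        WeeksWord.eval s t secondRelator = 1 := by decide
    exact fun s t => ⟨(h s t).1, (h s t).2⟩
  let χ : WeeksGroup →* Multiplicative (ZMod 5) :=
    WeeksGroup.lift (pair (Multiplicative.ofAdd (n : ZMod 5)) (Multiplicative.ofAdd (m : ZMod 5)))
  have hχ : ∀ w, χ (PresentedGroup.mk weeksRelators w) =
      Multiplicative.ofAdd ((φ w).toAdd : ZMod 5) := by
    intro w
    induction w using FreeGroup.induction_on with
    | C1 => simp
    | of i =>
      fin_cases i
      · have h : χ (PresentedGroup.mk weeksRelators (FreeGroup.of 0)) = _ :=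
          WeeksGroup.lift_genA (pair _ _)
        simpa [φ] using h
      · have h : χ (PresentedGroup.mk weeksRelators (FreeGroup.of 1)) = _ :=
          WeeksGroup.lift_genB (pair _ _)
        simpa [φ] using h
    | inv_of i h => simpa using h
    | mul x y hx hy => simp [hx, hy]
  -- The cone is pulled back along the corrected lift `E w * turn ^ (-k)`. Closure under products
  -- uses that `turn` commutes with every lift.
  let P : Subsemigroup WeeksGroup :=
    { carrier := {g | ∃ w k, PresentedGroup.mk weeksRelators w = g ∧
        φ w = Multiplicative.ofAdd (5 * k) ∧ E w * turn ^ (-k) ∈ positiveHomeomorph}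
      mul_mem' := by
        rintro _ _ ⟨u, k, rfl, hk, hk'⟩ ⟨v, l, rfl, hl, hl'⟩
        refine ⟨u * v, k + l, map_mul _ _ _, by rw [map_mul, hk, hl, mul_add, ofAdd_add], ?_⟩
        have h : E (u * v) * turn ^ (-(k + l)) = E u * turn ^ (-k) * (E v * turn ^ (-l)) := by
          rw [map_mul, neg_add, zpow_add, mul_assoc, mul_assoc, ← mul_assoc (turn ^ (-k)),
            ← ((commute_lift_turn commF commG v).zpow_right (-k)).eq, mul_assoc]
        rw [h]
        exact mul_mem hk' hl' }
  refine WeeksGroup.not_total_on_ker χ P ?_ fun g hg hg1 => ?_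
  · rintro ⟨w, k, hw, hk, hpos⟩
    obtain ⟨l, hl, hl'⟩ := eq_turn_zpow_of_mk_eq_one commF commG hm hn hw
    have hkl : k = l := by
      have h : 5 * k = 5 * l := Multiplicative.ofAdd.injective (hk.symm.trans hl)
      omega
    have hEw : E w = turn ^ l := hl'
    rw [hEw, hkl, zpow_neg, mul_inv_cancel] at hpos
    exact one_notMem_positiveHomeomorph hpos
  · obtain ⟨w, rfl⟩ := PresentedGroup.mk_surjective _ g
    rw [hχ, ofAdd_eq_one, ZMod.intCast_zmod_eq_zero_iff_dvd] at hg
    obtain ⟨k, hk⟩ := hg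
    have hk' : φ w = Multiplicative.ofAdd (5 * k) := congrArg Multiplicative.ofAdd hk
    have mono : StrictMono (E w * turn ^ (-k)) :=
      (strictMono_lift monoF monoG w).comp (strictMono_turn_zpow (-k))
    -- Injectivity of `ρ` enters here: a word lifting to a power of `turn` acts trivially on the
    -- circle.
    have hne : E w * turn ^ (-k) ≠ 1 := by
      intro h
      rw [zpow_neg, mul_inv_eq_one] at h
      have h1 := hlift w
      rw [h] at h1
      exact hg1 (hρ (by rw [h1.eq_one_of_turn_zpow, map_one]))
    rcases positiveHomeomorph_or mono hne with h | h
    · exact Or.inl ⟨w, k, rfl, hk', h⟩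
    · refine Or.inr ⟨w⁻¹, -k, map_inv _ _, by rw [map_inv, hk', mul_neg, ofAdd_neg], ?_⟩
      rwa [mul_inv_rev, ← zpow_neg, ← map_inv,
        ← ((commute_lift_turn commF commG w⁻¹).zpow_right _).eq] at h
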